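/- Let $K$ be a field, $t\in K$, and work in the ring $K[[q]]$ of formal power series. For a permutation $\sigma\in\mathfrak S_n$ let $P(\sigma)$ be the shape of the binary search tree obtained by inserting the letters $\sigma_n,\sigma_{n-1},\dots,\sigma_1$ in this order. Let $(\mathbf F_\sigma)$ and $\mathbf G_\sigma=\mathbf F_{\sigma^{-1}}$ be the dual bases of the algebra $\mathbf{FQSym}$ of free quasi-symmetric functions, realized over a totally ordered alphabet $A$ by $\mathbf G_\sigma(A)=\sum_{\mathrm{std}(w)=\sigma}w$, and put $\mathbf P_T=\sum_{P(\sigma)=T}\mathbf F_\sigma$ for a binary tree $T$. Let $f(A)\mapsto f(A\cdot(1-t))$ be the adjoint, for the scalar product $(\mathbf F_\sigma,\mathbf G_\tau)=\delta_{\sigma,\tau}$, of the map $f(A)\mapsto f((1-t)A)=f*\sigma_1((1-t)A)$, where $\sigma_1((1-t)A)=\lambda_{-t}(A)\sigma_1(A)=\sum_{k,l}(-t)^k\Lambda_kS_l$ and $*$ is the internal product $\mathbf F_\sigma*\mathbf F_\tau=\mathbf F_{\sigma\circ\tau}$. Denote by $f(\mathbb X)$, $\mathbb X=\frac1{1-q}\,\hat\times\,(1-t)$,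 the value of $f(A\cdot(1-t))$ at the (commutative) alphabet $A=\frac1{1-q}=\{\cdots<q^2<q<1\}$. For a node $s$ of a binary tree $T$, let $n_s$ be the size of the subtree with root $s$ and $n'_s$ the size of the left subtree of $s$, and let $$h_s(t)=\frac1{1-q^{n_s}}\begin{cases}q^{n_s}-q^{n'_s}t&\text{if $s$ is the right son of its father,}\\ 1-q^{n'_s}t&\text{otherwise.}\end{cases}$$ **Theorem.** Let $T$ be a binary tree with $n$ nodes, and $(q)_n=\prod_{i=1}^n(1-q^i)$. Then $$\mathbf P_T(\mathbb X)=\prod_{s\in T}h_s(t).$$ Moreover $$(q)_n\,\mathbf P_T(\mathbb X)=\sum_{(\sigma,\epsilon)\,:\,P(\sigma)=T}(-t)^{m(\epsilon)}q^{\mathrm{maj}(\sigma,\epsilon)},$$ so that, replacing $t$ by $-t$, the generating function of the signed permutations of shape $T$ by major index and number of signs is $$\sum_{(\sigma,\epsilon)\,:\,P(\sigma)=T}t^{m(\epsilon)}q^{\mathrm{maj}(\sigma,\epsilon)}=(q)_n\,\mathbf P_T(\mathbb X)|_{t\to-t}=(q)_n\prod_{s\in T}h_s(-t).$$ Here $(\sigma,\epsilon)$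 runs over $\mathfrak S_n\times\{\pm1\}^n$, $m(\epsilon)$ is the number of entries $-1$ of $\epsilon$, and $\mathrm{maj}(\sigma,\epsilon)$ is the sum of the $i\in\{1,\dots,n-1\}$ with $\epsilon_i\sigma_i>\epsilon_{i+1}\sigma_{i+1}$. Furthermore, $h_s$ is the contribution of the label of $s$ among these signed permutations: label the nodes of $T$ by $1,\dots,n$ so that $T$ is a binary search tree, and let $\ell(s)$ be the label of $s$. Then for all $u_1,\dots,u_n\in K$, $$\sum_{(\sigma,\epsilon)\,:\,P(\sigma)=T}\Big(\prod_{i\,:\,\epsilon_i=-1}(-u_{\sigma_i})\Big)q^{\mathrm{maj}(\sigma,\epsilon)}=(q)_n\prod_{s\in T}h_s(u_{\ell(s)}).$$ -/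

import Mathlib

noncomputable section

namespace HookTree

open PowerSeries Finset

/-! ### Free quasi-symmetric functions -/

/-- The homogeneous component of degree `n` of `FQSym` over `K`, as the space of formal
combinations of the basis elements `F_σ`, `σ ∈ 𝔖_n`. The ring multiplication of the group algebra
is the internal product of `FQSym`: `F_σ * F_τ = F_{σ ∘ τ}`. -/
abbrev FQSym (K : Type*) [Field K] (n : ℕ) := MonoidAlgebra K (Equiv.Perm (Fin n))

/-- The basis element `F_σ`. -/
def F (K : Type*) [Field K] {n : ℕ} (σ : Equiv.Perm (Fin n)) : FQSym K n :=
  MonoidAlgebra.single σ 1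

/-- The basis element `G_σ = F_{σ⁻¹}`. -/
def G (K : Type*) [Field K] {n : ℕ} (σ : Equiv.Perm (Fin n)) : FQSym K n := F K σ⁻¹

/-- The coefficient of `G_σ` in `x`. -/
def gCoeff {K : Type*} [Field K] {n : ℕ} (x : FQSym K n) (σ : Equiv.Perm (Fin n)) : K :=
  x.coeff σ⁻¹

/-- The standardization of a word `w = w_1 ⋯ w_n` over a totally ordered alphabet: number the
letters from the smallest to the largest one, equal letters from left to right.
(`Tuple.sort w` lists the positions in that order, hence the inverse.) -/
def std {α : Type*} [LinearOrder α] {n : ℕ} (w : Fin n → α) : Equiv.Perm (Fin n) :=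
  (Tuple.sort w)⁻¹

/-- The (outer) product of `FQSym`: `G_α G_β = ∑ G_γ` over the permutations `γ = u · v` with
`std u = α` and `std v = β`, extended bilinearly. -/
def outer {K : Type*} [Field K] {k l n : ℕ} (h : k + l = n) (x : FQSym K k) (y : FQSym K l) :
    FQSym K n :=
  ∑ γ : Equiv.Perm (Fin n),
    (gCoeff x (std fun i : Fin k => γ (Fin.cast h (Fin.castAdd l i))) *
      gCoeff y (std fun j : Fin l => γ (Fin.cast h (Fin.natAdd k j)))) • G K γ

/-- The noncommutative complete function `S_n = G_{12⋯n}`. -/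
def completeS (K : Type*) [Field K] (n : ℕ) : FQSym K n := G K 1

/-- The noncommutative elementary function `Λ_n = G_{n⋯21}`. -/
def elemLambda (K : Type*) [Field K] (n : ℕ) : FQSym K n := G K Fin.revPerm

/-- `S_n((1-t)A)`, the component of degree `n` of `σ_1((1-t)A) = λ_{-t}(A) σ_1(A)`. -/
def completeOneSub {K : Type*} [Field K] (t : K) (n : ℕ) : FQSym K n :=
  ∑ p ∈ (antidiagonal n).attach,
    (-t) ^ p.1.1 • outer (mem_antidiagonal.1 p.2) (elemLambda K p.1.1) (completeS K p.1.2)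

/-- The transformation `f(A) ↦ f((1-t)A) = f(A) * σ_1((1-t)A)` (internal product). -/
def oneSubMul {K : Type*} [Field K] (t : K) {n : ℕ} (x : FQSym K n) : FQSym K n :=
  x * completeOneSub t n

/-- The scalar product of `FQSym`: `(G_σ, G_τ) = δ_{σ, τ⁻¹}`, so that `F` and `G` are dual
bases. -/
def pairing {K : Type*} [Field K] {n : ℕ} (x y : FQSym K n) : K :=
  ∑ σ : Equiv.Perm (Fin n), x.coeff σ * y.coeff σ⁻¹

/-- The transformation `f(A) ↦ f(A·(1-t))`, adjoint to `f(A) ↦ f((1-t)A)`. -/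
def mulOneSub {K : Type*} [Field K] (t : K) {n : ℕ} (x : FQSym K n) : FQSym K n :=
  ∑ τ : Equiv.Perm (Fin n), pairing x (oneSubMul t (G K τ)) • F K τ

/-- `mulOneSub t` is the adjoint of `oneSubMul t`. -/
theorem pairing_mulOneSub {K : Type*} [Field K] (t : K) {n : ℕ} (x y : FQSym K n) :
    pairing (mulOneSub t x) y = pairing x (oneSubMul t y) := by
  have hy : y = ∑ τ : Equiv.Perm (Fin n), y.coeff τ⁻¹ • G K τ := by
    ext a
    simp only [G, F, MonoidAlgebra.coeff_sum, MonoidAlgebra.coeff_smul, Finsupp.finsetSum_apply,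
      Finsupp.smul_apply, MonoidAlgebra.coeff_single, Finsupp.single_apply, smul_eq_mul,
      mul_ite, mul_one, mul_zero]
    rw [Finset.sum_eq_single a⁻¹] <;> aesop
  have hx : ∀ σ : Equiv.Perm (Fin n),
      (mulOneSub t x).coeff σ = pairing x (oneSubMul t (G K σ)) := by
    intro σ
    simp [mulOneSub, F, MonoidAlgebra.coeff_sum, Finsupp.finsetSum_apply,
      Finsupp.single_apply]
  conv_rhs => rw [hy]
  unfold pairing at *
  simp only [hx]
  simp only [oneSubMul, Finset.sum_mul, MonoidAlgebra.coeff_sum, Finsupp.finsetSum_apply,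
    smul_mul_assoc, MonoidAlgebra.coeff_smul, Finsupp.smul_apply, smul_eq_mul, Finset.mul_sum]
  rw [Finset.sum_comm]
  refine Finset.sum_congr rfl fun a _ => Finset.sum_congr rfl fun b _ => by ring

/-- The specialization `A = 1/(1-q)` of `x ∈ FQSym_n`, as a formal power series in `q = X`.
In the realization `G_σ(A) = ∑_{std w = σ} w`, the letters are the powers of `q`, ordered by
`⋯ < q² < q < 1`; the letter `q^i` is encoded by its exponent `i`, whence the dual order on `ℕ`.
The coefficient of `q^d` is the sum, over the words `w` with exponents of sum `d`, of the
coefficient of `w` in `x(A)`. -/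
def specGeom {K : Type*} [Field K] {n : ℕ} (x : FQSym K n) : K⟦X⟧ :=
  PowerSeries.mk fun d =>
    ∑ w ∈ Finset.Nat.antidiagonalTuple n d, gCoeff x (std fun i => OrderDual.toDual (w i))

/-- The specialization of `x` at the alphabet `𝕏 = 1/(1-q) ×̂ (1-t)`: the value at `A = 1/(1-q)`
of `x(A·(1-t))`. -/
def specX {K : Type*} [Field K] (t : K) {n : ℕ} (x : FQSym K n) : K⟦X⟧ :=
  specGeom (mulOneSub t x)

/-! ### Binary search trees and the elements `P_T` -/

/-- Insertion of a letter in a binary search tree. -/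
def bstInsert {α : Type*} [LinearOrder α] (a : α) : BinaryTree α → BinaryTree α
  | .nil => .node a .nil .nil
  | .node b l r => if a ≤ b then .node b (bstInsert a l) r else .node b l (bstInsert a r)

/-- The shape `P(σ)` of the binary search tree of `σ`, obtained by inserting the letters
`σ_n, …, σ_1` in this order (so that the root is `σ_n`). -/
def bstShape {n : ℕ} (σ : Equiv.Perm (Fin n)) : BinaryTree Unit :=
  ((List.ofFn σ).foldr bstInsert .nil).map fun _ => ()

/-- `P_T = ∑_{P(σ) = T} F_σ`. -/
def P (K : Type*) [Field K] (T : BinaryTree Unit) : FQSym K T.numNodes :=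
  ∑ σ : Equiv.Perm (Fin T.numNodes) with bstShape σ = T, F K σ

/-! ### Nodes and hook-content factors -/

/-- The data of a node `s` of a binary tree: the size of the subtree with root `s`, the size of
the left subtree of `s`, whether `s` is the right son of its father, and the label of `s` in the
standard labelling (by `1, …, n`) that makes the tree a binary search tree. -/
structure NodeData where
  size : ℕ
  leftSize : ℕ
  isRightSon : Bool
  label : ℕ

/-- The nodes of a subtree whose labels start at `o + 1`; `b` tells whether the root of
the subtree is a right son. -/
def nodesAux : ℕ → Bool → BinaryTree Unit → List NodeData
  | _, _, .nil => []
  | o, b, .node _ l r =>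
    nodesAux o false l ++
      ⟨l.numNodes + r.numNodes + 1, l.numNodes, b, o + l.numNodes + 1⟩ ::
        nodesAux (o + l.numNodes + 1) true r

/-- The list of the nodes of a binary tree (the root is not a right son). -/
def nodes (T : BinaryTree Unit) : List NodeData := nodesAux 0 false T

/-- The `(q,t)`-hook-content factor of a node: `(q^n - q^{n'} t)/(1 - q^n)` for a right son and
`(1 - q^{n'} t)/(1 - q^n)` otherwise. -/
def hookContent {K : Type*} [Field K] (t : K) (s : NodeData) : K⟦X⟧ :=
  ((if s.isRightSon then X ^ s.size else 1) - X ^ s.leftSize * C t) * (1 - X ^ s.size)⁻¹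

/-! ### Signed permutations -/

/-- The signed word `(σ, ε)`, with letters `ε_i σ_i ∈ {±1, …, ±n}`. -/
def signedWord {n : ℕ} (σ : Equiv.Perm (Fin n)) (ε : Fin n → ℤˣ) (i : Fin n) : ℤ :=
  (ε i : ℤ) * ((σ i : ℕ) + 1)

/-- The major index: the sum of the positions `i ∈ {1, …, n-1}` with `w_i > w_{i+1}`. -/
def maj {n : ℕ} (w : Fin n → ℤ) : ℕ :=
  ∑ i : Fin n, if ∃ h : (i : ℕ) + 1 < n, w ⟨i + 1, h⟩ < w i then (i : ℕ) + 1 else 0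

/-- `m(ε)`, the number of entries `-1`. -/
def numNeg {n : ℕ} (ε : Fin n → ℤˣ) : ℕ := #{i : Fin n | ε i = -1}

/-- `(q)_n = (1-q)(1-q²)⋯(1-q^n)`. -/
def qPoch (K : Type*) [Field K] (n : ℕ) : K⟦X⟧ := ∏ i ∈ Finset.range n, (1 - X ^ (i + 1))

/-- `∑ t^{m(ε)} q^{maj(σ,ε)}` over the signed permutations `(σ, ε)` with `P(σ) = T`. -/
def signedGF {K : Type*} [Field K] (t : K) (T : BinaryTree Unit) : K⟦X⟧ :=
  ∑ σ : Equiv.Perm (Fin T.numNodes) with bstShape σ = T, ∑ ε : Fin T.numNodes → ℤˣ,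
    C t ^ numNeg ε * X ^ maj (signedWord σ ε)

/-- The refinement of `signedGF` in which each label has its own variable: a minus sign on the
letter `j` has weight `u j`. -/
def signedGFLabels {K : Type*} [Field K] (u : ℕ → K) (T : BinaryTree Unit) : K⟦X⟧ :=
  ∑ σ : Equiv.Perm (Fin T.numNodes) with bstShape σ = T, ∑ ε : Fin T.numNodes → ℤˣ,
    (∏ i : Fin T.numNodes with ε i = -1, C (u ((σ i : ℕ) + 1))) * X ^ maj (signedWord σ ε)

end HookTree

end

/-!
Fill the nodes of `T` with natural numbers `f`, label them by an injective `ω`, and sort them by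
decreasing `f`, ties being broken by increasing `ω`. The sorting permutation `σ` satisfies
`P(σ) = T` exactly when `f` grows away from the root, strictly so along the edges on which `ω`
increases: `f` is a `(P, ω)`-partition of the tree. Removing the root shows that the generating
function of these fillings is the product over the nodes `s` of `1 / (1 - q^{n_s})`, times
`q^{n_s}` if `s` is a descent, i.e. has a larger label than its father. For a chain this gives
MacMahon's theorem: the fillings sorted by a given `σ` contribute `q^{maj(ω ∘ σ)} / (q)_n`. Hence
the sum of `q^{maj(ω ∘ σ)}` over the `σ` of shape `T` is `(q)_n` times the product over the nodes.
If `ω` is the infix numbering with signs, whether a node is a descent depends on one sign only, that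
of its father for a left son and its own for a right son, so that the sum over the signs factors
into the `h_s`.

In `FQSym`, the component of degree `n` of `σ_1((1-t)A)` is the sum over the sign vectors `δ` of
`(-t)^{m(δ)} F_{std(δ_1 1, …, δ_n n)}`, and the adjoint of the internal product with it sends `F_σ`
to the sum of the `(-t)^{m(ε)} F_{std(σ, ε)}`. Since `F_τ(1/(1-q)) = q^{maj τ} / (q)_n`, the value
of `(q)_n P_T` at `𝕏` is the signed generating function.
-/

noncomputable section

namespace HookTree

open PowerSeries Finset
open scoped PowerSeries.WithPiTopology

/-! ### Power series as sums of monomials -/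

section Summation

variable {K : Type*} [Field K] [UniformSpace K] [DiscreteUniformity K]

theorem nonarchimedeanRing_powerSeries : NonarchimedeanRing K⟦X⟧ where
  is_nonarchimedean U hU := by
    obtain ⟨I, hI, hIU⟩ :=
      (IsLinearTopology.hasBasis_open_ideal (R := MvPowerSeries Unit K)).mem_iff.1 hU
    exact ⟨⟨I.toAddSubgroup, hI⟩, hIU⟩

theorem hasSum_mul {ι κ : Type*} {f : ι → K⟦X⟧} {g : κ → K⟦X⟧} {a b : K⟦X⟧} (hf : HasSum f a)
    (hg : HasSum g b) : HasSum (fun i : ι × κ => f i.1 * g i.2) (a * b) :=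
  have := nonarchimedeanRing_powerSeries (K := K)
  hf.mul_of_nonarchimedean hg

theorem hasSum_X_pow_mul {n : ℕ} (hn : 0 < n) :
    HasSum (fun k : ℕ => (X : K⟦X⟧) ^ (n * k)) (1 - X ^ n)⁻¹ := by
  have h : constantCoeff (X ^ n : K⟦X⟧) = 0 := by simp [hn.ne']
  rw [← (PowerSeries.eq_inv_iff_mul_eq_one (by simp [h])).2
    (WithPiTopology.tsum_pow_mul_one_sub_of_constantCoeff_eq_zero h)]
  simpa only [pow_mul] using (WithPiTopology.summable_pow_of_constantCoeff_eq_zero h).hasSum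

end Summation

/-! ### Infix numbering of the nodes -/

section Infix

variable {u : Unit} {l r : BinaryTree Unit} {β : Type*}

/-- The number of a node of the left subtree, when the nodes of every binary tree are numbered
from `0` in infix order. -/
def infixLeft (i : Fin l.numNodes) : Fin (BinaryTree.node u l r).numNodes :=
  ⟨i, by rw [BinaryTree.numNodes]; omega⟩

/-- The number of the root, in infix order. -/
def infixRoot : Fin (BinaryTree.node u l r).numNodes :=
  ⟨l.numNodes, by rw [BinaryTree.numNodes]; omega⟩

/-- The number of a node of the right subtree, in infix order. -/
def infixRight (i : Fin r.numNodes) : Fin (BinaryTree.node u l r).numNodes :=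
  ⟨l.numNodes + 1 + i, by rw [BinaryTree.numNodes]; omega⟩

theorem infixLeft_lt_infixRoot (i : Fin l.numNodes) :
    (infixLeft i : Fin (BinaryTree.node u l r).numNodes) < infixRoot := i.2

theorem infixRoot_lt_infixRight (i : Fin r.numNodes) :
    infixRoot < (infixRight i : Fin (BinaryTree.node u l r).numNodes) :=
  Nat.lt_add_right _ (Nat.lt_succ_self _)

theorem strictMono_infixLeft :
    StrictMono (infixLeft : Fin l.numNodes → Fin (BinaryTree.node u l r).numNodes) :=
  fun _ _ h => h

theorem strictMono_infixRight :
    StrictMono (infixRight : Fin r.numNodes → Fin (BinaryTree.node u l r).numNodes) :=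
  fun _ _ h => Nat.add_lt_add_left h _

theorem infix_cases {p : Fin (BinaryTree.node u l r).numNodes → Prop}
    (left : ∀ i, p (infixLeft i)) (root : p infixRoot) (right : ∀ i, p (infixRight i)) (x) :
    p x := by
  have hx : (x : ℕ) < l.numNodes + r.numNodes + 1 := x.2
  rcases lt_trichotomy (x : ℕ) l.numNodes with h | h | h
  · exact left ⟨x, h⟩
  · rwa [show x = infixRoot from Fin.ext h]
  · rw [show x = infixRight ⟨x - (l.numNodes + 1), by omega⟩ from
      Fin.ext (by simp only [infixRight]; omega)]
    exact right _

theorem exists_lt_infixRoot_and {p : Fin (BinaryTree.node u l r).numNodes → Prop} :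
    (∃ x < infixRoot, p x) ↔ ∃ i, p (infixLeft i) :=
  ⟨fun ⟨x, hx, h⟩ => ⟨⟨x, hx⟩, h⟩, fun ⟨i, h⟩ => ⟨_, infixLeft_lt_infixRoot i, h⟩⟩

theorem exists_gt_infixRoot_and {p : Fin (BinaryTree.node u l r).numNodes → Prop} :
    (∃ x > infixRoot, p x) ↔ ∃ i, p (infixRight i) := by
  refine ⟨fun ⟨x, hx, h⟩ => ?_, fun ⟨i, h⟩ => ⟨_, infixRoot_lt_infixRight i, h⟩⟩
  induction x using infix_cases with
  | left i => exact absurd hx (infixLeft_lt_infixRoot i).not_gt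
  | root => exact absurd hx (lt_irrefl _)
  | right i => exact ⟨i, h⟩

/-- The nodes of a tree are those of its left subtree, its root, and those of its right
subtree. -/
def infixEquiv : Fin l.numNodes ⊕ Option (Fin r.numNodes) ≃ Fin (BinaryTree.node u l r).numNodes :=
  .ofBijective (Sum.elim infixLeft (Option.elim · infixRoot infixRight)) <| by
    refine ⟨Function.Injective.sumElim strictMono_infixLeft.injective ?_ ?_, ?_⟩
    · rintro (_ | i) (_ | j) h
      · rfl
      · exact absurd h (infixRoot_lt_infixRight j).ne
      · exact absurd h (infixRoot_lt_infixRight i).ne'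
      · exact congrArg some (strictMono_infixRight.injective h)
    · rintro i (_ | j)
      · exact (infixLeft_lt_infixRoot i).ne
      · exact ((infixLeft_lt_infixRoot i).trans (infixRoot_lt_infixRight j)).ne
    · exact infix_cases (fun i => ⟨.inl i, rfl⟩) ⟨.inr none, rfl⟩ fun i => ⟨.inr (some i), rfl⟩

@[to_additive]
theorem prod_infix [CommMonoid β] (f : Fin (BinaryTree.node u l r).numNodes → β) :
    ∏ x, f x = (∏ i, f (infixLeft i)) * f infixRoot * ∏ i, f (infixRight i) := by
  rw [← Equiv.prod_comp infixEquiv, Fintype.prod_sum_type, Fintype.prod_option, mul_assoc]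
  rfl

/-- The function on the nodes of a tree with given values on the left subtree, at the root and on
the right subtree. -/
def infixElim (f : Fin l.numNodes → β) (b : β) (g : Fin r.numNodes → β)
    (x : Fin (BinaryTree.node u l r).numNodes) : β :=
  Sum.elim f (Option.elim · b g) (infixEquiv.symm x)

variable (f : Fin l.numNodes → β) (b : β) (g : Fin r.numNodes → β)

theorem infixElim_left (i : Fin l.numNodes) : infixElim (u := u) f b g (infixLeft i) = f i :=
  congrArg (Sum.elim f (Option.elim · b g)) (infixEquiv.symm_apply_apply (.inl i))

theorem infixElim_root : infixElim (u := u) f b g infixRoot = b :=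
  congrArg (Sum.elim f (Option.elim · b g)) (infixEquiv.symm_apply_apply (.inr none))

theorem infixElim_right (i : Fin r.numNodes) : infixElim (u := u) f b g (infixRight i) = g i :=
  congrArg (Sum.elim f (Option.elim · b g)) (infixEquiv.symm_apply_apply (.inr (some i)))

end Infix

/-! ### Heap-ordered fillings -/

section SortKey

variable {α ι : Type*} [LinearOrder ι] {f : α → ℕ} {ω : α → ι}

/-- Sorting by this key means sorting by decreasing `f`, ties being broken by increasing `ω`. -/
def sortKey (f : α → ℕ) (ω : α → ι) (x : α) : ℕᵒᵈ ×ₗ ι :=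
  toLex (OrderDual.toDual (f x), ω x)

theorem sortKey_lt_iff {x : α} {m : ℕ} {v : ι} :
    sortKey f ω x < toLex (OrderDual.toDual m, v) ↔ m < f x ∨ f x = m ∧ ω x < v := by
  simp [sortKey, Prod.Lex.toLex_lt_toLex]

theorem sortKey_le_sortKey {x y : α} :
    sortKey f ω x ≤ sortKey f ω y ↔ f y < f x ∨ f x = f y ∧ ω x ≤ ω y := by
  simp [sortKey, Prod.Lex.toLex_le_toLex]

omit [LinearOrder ι] in
theorem sortKey_injective (hω : Function.Injective ω) : Function.Injective (sortKey f ω) :=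
  fun _ _ h => hω (congrArg (fun x => (ofLex x).2) h)

end SortKey

section HeapOrdered

variable {κ κ' ι : Type*} [LinearOrder κ] [LinearOrder κ'] [LinearOrder ι]

/-- The key `k`, a function on the nodes in infix order, makes `T` a decreasing tree: in every
subtree the root has the largest key. -/
def HeapOrdered : (T : BinaryTree Unit) → (Fin T.numNodes → κ) → Prop
  | .nil, _ => True
  | .node _ l r, k =>
    (∀ i, k (infixLeft i) < k infixRoot) ∧ (∀ i, k (infixRight i) < k infixRoot) ∧
      HeapOrdered l (k ∘ infixLeft) ∧ HeapOrdered r (k ∘ infixRight)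

theorem HeapOrdered.le_root {u : Unit} {l r : BinaryTree Unit}
    {k : Fin (BinaryTree.node u l r).numNodes → κ} (h : HeapOrdered _ k) (x) : k x ≤ k infixRoot :=
  infix_cases (p := fun x => k x ≤ k infixRoot) (fun i => (h.1 i).le) le_rfl
    (fun i => (h.2.1 i).le) x

theorem heapOrdered_congr {T : BinaryTree Unit} {k : Fin T.numNodes → κ} {k' : Fin T.numNodes → κ'}
    (h : ∀ i j, k i < k j ↔ k' i < k' j) : HeapOrdered T k ↔ HeapOrdered T k' := by
  induction T with
  | nil => rfl
  | node u l r ihl ihr =>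
    have hl := ihl fun i j => h (infixLeft i) (infixLeft j)
    have hr := ihr fun i j => h (infixRight i) (infixRight j)
    simp only [HeapOrdered, h]
    exact and_congr_right' (and_congr_right' (and_congr hl hr))

theorem heapOrdered_sortKey_add_iff {T : BinaryTree Unit} {f : Fin T.numNodes → ℕ}
    {ω : Fin T.numNodes → ι} (c : ℕ) :
    HeapOrdered T (sortKey (fun i => f i + c) ω) ↔ HeapOrdered T (sortKey f ω) :=
  heapOrdered_congr fun i j => by
    change sortKey (fun i => f i + c) ω i < toLex (OrderDual.toDual (f j + c), ω j) ↔
      sortKey f ω i < toLex (OrderDual.toDual (f j), ω j)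
    simp only [sortKey_lt_iff, add_lt_add_iff_right, add_left_inj]

/-- The least possible difference between the values of a heap-ordered filling of `T`, whose
labels are `ω`, and the value of a father of `T` with label `v`. -/
def gap : (T : BinaryTree Unit) → (Fin T.numNodes → ι) → ι → ℕ
  | .nil, _, _ => 0
  | .node _ _ _, ω, v => if ω infixRoot < v then 0 else 1

theorem forall_sortKey_lt_iff {T : BinaryTree Unit} {f : Fin T.numNodes → ℕ}
    {ω : Fin T.numNodes → ι} (h : HeapOrdered T (sortKey f ω)) {m : ℕ} {v : ι} :
    (∀ i, sortKey f ω i < toLex (OrderDual.toDual m, v)) ↔ ∀ i, m + gap T ω v ≤ f i := by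
  cases T with
  | nil => exact ⟨fun _ i => i.elim0, fun _ i => i.elim0⟩
  | node u l r =>
    have hroot : sortKey f ω infixRoot < toLex (OrderDual.toDual m, v) ↔
        m + gap (.node u l r) ω v ≤ f infixRoot := by
      rw [sortKey_lt_iff, gap]
      split_ifs with hv <;> simp only [hv, and_true, and_false, or_false] <;> omega
    refine ⟨fun H x => (hroot.1 (H _)).trans ?_, fun H x => (h.le_root x).trans_lt (hroot.2 (H _))⟩
    have := sortKey_le_sortKey.1 (h.le_root x)
    omega

theorem heapOrdered_node_sortKey_iff {u : Unit} {l r : BinaryTree Unit}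
    {f : Fin (BinaryTree.node u l r).numNodes → ℕ} {ω : Fin (BinaryTree.node u l r).numNodes → ι} :
    HeapOrdered _ (sortKey f ω) ↔
      (∀ i, f infixRoot + gap l (ω ∘ infixLeft) (ω infixRoot) ≤ f (infixLeft i)) ∧
      (∀ i, f infixRoot + gap r (ω ∘ infixRight) (ω infixRoot) ≤ f (infixRight i)) ∧
      HeapOrdered l (sortKey (f ∘ infixLeft) (ω ∘ infixLeft)) ∧
      HeapOrdered r (sortKey (f ∘ infixRight) (ω ∘ infixRight)) := by
  constructor
  · rintro ⟨hl, hr, hl', hr'⟩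
    exact ⟨(forall_sortKey_lt_iff hl').1 hl, (forall_sortKey_lt_iff hr').1 hr, hl', hr'⟩
  · rintro ⟨hl, hr, hl', hr'⟩
    exact ⟨(forall_sortKey_lt_iff hl').2 hl, (forall_sortKey_lt_iff hr').2 hr, hl', hr'⟩

end HeapOrdered

section HookFormula

variable {ι : Type*} [LinearOrder ι]

/-- The fillings of the nodes of `T` for which the tree, with nodes labelled by `ω`, is heap-ordered
with respect to the sorting key. These are the `(P, ω)`-partitions of Stanley for the poset of the
nodes of `T`. -/
abbrev HeapFilling (T : BinaryTree Unit) (ω : Fin T.numNodes → ι) : Type :=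
  {f : Fin T.numNodes → ℕ // HeapOrdered T (sortKey f ω)}

/-- A filling of a tree is given by the value of the root and by the fillings of both subtrees
obtained by subtracting the least possible value. -/
def HeapFilling.nodeEquiv {u : Unit} {l r : BinaryTree Unit}
    (ω : Fin (BinaryTree.node u l r).numNodes → ι) :
    ℕ × HeapFilling l (ω ∘ infixLeft) × HeapFilling r (ω ∘ infixRight) ≃ HeapFilling _ ω where
  toFun x := ⟨infixElim (fun i => x.2.1.1 i + (x.1 + gap l (ω ∘ infixLeft) (ω infixRoot))) x.1
      (fun i => x.2.2.1 i + (x.1 + gap r (ω ∘ infixRight) (ω infixRoot))), by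
    simp only [heapOrdered_node_sortKey_iff, Function.comp_def, infixElim_left, infixElim_root,
      infixElim_right, heapOrdered_sortKey_add_iff, le_add_iff_nonneg_left, zero_le, implies_true,
      true_and]
    exact ⟨x.2.1.2, x.2.2.2⟩⟩
  invFun f :=
    (f.1 infixRoot,
      ⟨fun i => f.1 (infixLeft i) - (f.1 infixRoot + gap l (ω ∘ infixLeft) (ω infixRoot)), by
        obtain ⟨hle, -, h, -⟩ := heapOrdered_node_sortKey_iff.1 f.2
        rw [← heapOrdered_sortKey_add_iff, funext fun i => Nat.sub_add_cancel (hle i)]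
        exact h⟩,
      ⟨fun i => f.1 (infixRight i) - (f.1 infixRoot + gap r (ω ∘ infixRight) (ω infixRoot)), by
        obtain ⟨-, hle, -, h⟩ := heapOrdered_node_sortKey_iff.1 f.2
        rw [← heapOrdered_sortKey_add_iff, funext fun i => Nat.sub_add_cancel (hle i)]
        exact h⟩)
  left_inv x := by
    simp only [infixElim_left, infixElim_root, infixElim_right, Nat.add_sub_cancel]
  right_inv f := by
    obtain ⟨hl, hr, -⟩ := heapOrdered_node_sortKey_iff.1 f.2
    refine Subtype.ext (funext (infix_cases (fun i => ?_) ?_ fun i => ?_))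
    · exact (infixElim_left _ _ _ i).trans (Nat.sub_add_cancel (hl i))
    · exact infixElim_root _ _ _
    · exact (infixElim_right _ _ _ i).trans (Nat.sub_add_cancel (hr i))

theorem HeapFilling.sum_nodeEquiv {u : Unit} {l r : BinaryTree Unit}
    (ω : Fin (BinaryTree.node u l r).numNodes → ι)
    (x : ℕ × HeapFilling l (ω ∘ infixLeft) × HeapFilling r (ω ∘ infixRight)) :
    ∑ i, (nodeEquiv ω x).1 i =
      l.numNodes * gap l (ω ∘ infixLeft) (ω infixRoot) +
        r.numNodes * gap r (ω ∘ infixRight) (ω infixRoot) +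
        ((l.numNodes + r.numNodes + 1) * x.1 + (∑ i, x.2.1.1 i + ∑ i, x.2.2.1 i)) := by
  simp only [nodeEquiv, Equiv.coe_fn_mk, sum_infix, infixElim_left, infixElim_root,
    infixElim_right, sum_add_distrib, sum_const, card_univ, Fintype.card_fin, smul_eq_mul]
  ring

/-- The sum of the sizes of the subtrees whose root is a descent of the labelling `ω`, i.e. has a
larger label than its father. -/
def treeMaj : (T : BinaryTree Unit) → (Fin T.numNodes → ι) → ℕ
  | .nil, _ => 0
  | .node _ l r, ω =>
    treeMaj l (ω ∘ infixLeft) + treeMaj r (ω ∘ infixRight) +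
      l.numNodes * gap l (ω ∘ infixLeft) (ω infixRoot) +
      r.numNodes * gap r (ω ∘ infixRight) (ω infixRoot)

/-- The product of the `1 / (1 - q ^ n_s)` over the nodes `s`. -/
def hookSeries (K : Type*) [Field K] : BinaryTree Unit → K⟦X⟧
  | .nil => 1
  | .node _ l r => hookSeries K l * hookSeries K r * (1 - X ^ (l.numNodes + r.numNodes + 1))⁻¹

theorem hasSum_heapFilling {K : Type*} [Field K] [UniformSpace K] [DiscreteUniformity K]
    (T : BinaryTree Unit) (ω : Fin T.numNodes → ι) :
    HasSum (fun f : HeapFilling T ω => (X : K⟦X⟧) ^ ∑ i, f.1 i)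
      (X ^ treeMaj T ω * hookSeries K T) := by
  induction T with
  | nil =>
    let : Unique (HeapFilling .nil ω) :=
      ⟨⟨⟨fun i => i.elim0, trivial⟩⟩, fun f => Subtype.ext (funext fun i => i.elim0)⟩
    rw [treeMaj, hookSeries, mul_one]
    exact hasSum_unique _
  | node u l r ihl ihr =>
    have h := (hasSum_mul (hasSum_X_pow_mul (K := K) (Nat.succ_pos (l.numNodes + r.numNodes)))
      (hasSum_mul (ihl (ω ∘ infixLeft)) (ihr (ω ∘ infixRight)))).mul_left
        (X ^ (l.numNodes * gap l (ω ∘ infixLeft) (ω infixRoot) +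
          r.numNodes * gap r (ω ∘ infixRight) (ω infixRoot)))
    simp only [← pow_add, Nat.succ_eq_add_one, ← HeapFilling.sum_nodeEquiv] at h
    rw [← (HeapFilling.nodeEquiv ω).hasSum_iff]
    refine (congrArg (fun s => HasSum _ s) ?_).mp h
    simp only [treeMaj, hookSeries, pow_add]
    ring

end HookFormula

/-! ### Words with a given sorting permutation -/

theorem sort_eq_iff_of_injective {κ : Type*} [LinearOrder κ] {n : ℕ} {k : Fin n → κ}
    (hk : Function.Injective k) {σ : Equiv.Perm (Fin n)} :
    Tuple.sort k = σ ↔ StrictMono (k ∘ σ) := by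
  rw [eq_comm, Tuple.eq_sort_iff]
  refine ⟨fun h => h.1.strictMono_of_injective (hk.comp σ.injective), fun h => ⟨h.monotone, ?_⟩⟩
  exact fun i j hij heq => absurd heq (h hij).ne

/-- The tree with `n` nodes none of which has a right son. In infix order, its nodes form a chain
with the last node as the root. -/
def leftComb : ℕ → BinaryTree Unit
  | 0 => .nil
  | n + 1 => .node () (leftComb n) .nil

theorem numNodes_leftComb (n : ℕ) : (leftComb n).numNodes = n := by
  induction n with
  | zero => rfl
  | succ n ih => rw [leftComb, BinaryTree.numNodes, BinaryTree.numNodes, ih]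

theorem hookSeries_leftComb (K : Type*) [Field K] (n : ℕ) :
    hookSeries K (leftComb n) = (qPoch K n)⁻¹ := by
  induction n with
  | zero => simp [leftComb, hookSeries, qPoch]
  | succ n ih =>
    rw [leftComb, hookSeries, hookSeries, ih, numNodes_leftComb, BinaryTree.numNodes, qPoch,
      qPoch, prod_range_succ, PowerSeries.mul_inv_rev, mul_one, add_zero, mul_comm]

theorem heapOrdered_leftComb_iff {κ : Type*} [LinearOrder κ] {n : ℕ}
    {k : Fin (leftComb n).numNodes → κ} : HeapOrdered (leftComb n) k ↔ StrictMono k := by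
  induction n with
  | zero => exact ⟨fun _ i => i.elim0, fun _ => trivial⟩
  | succ n ih =>
    constructor
    · rintro ⟨hroot, -, hl, -⟩
      refine infix_cases (fun i => infix_cases (fun j hij => ih.1 hl hij) ?_ fun j => j.elim0)
        (infix_cases (fun j hij => ?_) ?_ fun j => j.elim0) fun i => i.elim0
      · exact fun _ => hroot i
      · exact absurd hij (infixLeft_lt_infixRoot j).not_gt
      · exact fun hij => absurd hij (lt_irrefl _)
    · exact fun h => ⟨fun i => h (infixLeft_lt_infixRoot i), fun i => i.elim0,
        ih.2 (h.comp strictMono_infixLeft), trivial⟩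

theorem maj_eq_sum_succ_lt_castSucc {n : ℕ} (w : Fin (n + 1) → ℤ) :
    maj w = ∑ i : Fin n, if w i.succ < w i.castSucc then (i : ℕ) + 1 else 0 := by
  rw [maj, Fin.sum_univ_castSucc, if_neg fun h => lt_irrefl _ h.1, add_zero]
  refine sum_congr rfl fun i _ => if_congr ⟨fun h => h.2, fun h => ⟨?_, h⟩⟩ rfl rfl
  exact Nat.succ_lt_succ i.2

theorem maj_fin_add_two {n : ℕ} {w : Fin (n + 2) → ℤ} (hw : Function.Injective w) :
    maj w = maj (w ∘ Fin.castSucc) +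
      (n + 1) * if w (Fin.last n).castSucc < w (Fin.last (n + 1)) then 0 else 1 := by
  have hdesc : w (Fin.last n).succ < w (Fin.last n).castSucc ↔
      ¬ w (Fin.last n).castSucc < w (Fin.last (n + 1)) := by
    rw [not_lt, (hw.ne (Fin.castSucc_lt_last _).ne').le_iff_lt, Fin.succ_last]
  rw [maj_eq_sum_succ_lt_castSucc, Fin.sum_univ_castSucc, maj_eq_sum_succ_lt_castSucc,
    if_congr hdesc rfl rfl, ite_not, mul_ite, mul_zero, mul_one]
  rfl

theorem treeMaj_leftComb {n : ℕ} {ω : Fin (leftComb n).numNodes → ℤ}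
    (hω : Function.Injective ω) : treeMaj (leftComb n) ω = maj ω := by
  induction n with
  | zero => rfl
  | succ n ih =>
    have ih := ih (hω.comp strictMono_infixLeft.injective)
    cases n with
    | zero =>
      exact (Fintype.sum_eq_zero _ fun i => if_neg fun h =>
        Nat.not_lt_zero _ (Nat.lt_of_succ_lt_succ h.1)).symm
    | succ n => exact (congrArg (· + _) ih).trans (maj_fin_add_two hω).symm

theorem hasSum_sort_sortKey_eq {K : Type*} [Field K] [UniformSpace K] [DiscreteUniformity K]
    {n : ℕ} {ω : Fin n → ℤ} (hω : Function.Injective ω) (σ : Equiv.Perm (Fin n)) :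
    HasSum (fun f : {f : Fin n → ℕ // Tuple.sort (sortKey f ω) = σ} => (X : K⟦X⟧) ^ ∑ i, f.1 i)
      (X ^ maj (ω ∘ σ) * (qPoch K n)⁻¹) := by
  obtain ⟨m, rfl⟩ : ∃ m, n = (leftComb m).numNodes := ⟨n, (numNodes_leftComb n).symm⟩
  have h := hasSum_heapFilling (K := K) (leftComb m) (ω ∘ σ)
  rw [treeMaj_leftComb (hω.comp σ.injective), hookSeries_leftComb,
    ← congrArg (qPoch K) (numNodes_leftComb m)] at h
  let e : {f : Fin (leftComb m).numNodes → ℕ // Tuple.sort (sortKey f ω) = σ} ≃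
      HeapFilling (leftComb m) (ω ∘ σ) :=
    (σ.symm.arrowCongr (Equiv.refl ℕ)).subtypeEquiv fun f => by
      rw [sort_eq_iff_of_injective (sortKey_injective hω), heapOrdered_leftComb_iff]
      rfl
  rw [← e.hasSum_iff] at h
  refine (congrArg (fun g => HasSum g _) (funext fun f => ?_)).mp h
  exact congrArg (X ^ ·) (Equiv.sum_comp σ f.1)

/-! ### Binary search trees of sorted words -/

section ListShape

variable {α κ : Type*} [LinearOrder α] [LinearOrder κ]

/-- The shape of the binary search tree of a word; `bstShape` is the case of a permutation, seen as
the word of its values. -/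
def listShape (w : List α) : BinaryTree Unit :=
  (w.foldr bstInsert .nil).map fun _ => ()

theorem foldr_bstInsert_node (a : α) (l r : BinaryTree α) (w : List α) :
    w.foldr bstInsert (.node a l r) =
      .node a ((w.filter (· ≤ a)).foldr bstInsert l) ((w.filter (a < ·)).foldr bstInsert r) := by
  induction w with
  | nil => rfl
  | cons b w ih =>
    by_cases h : b ≤ a
    · simp [ih, bstInsert, h, not_lt.2 h]
    · simp [ih, bstInsert, h, not_le.1 h]

theorem listShape_append_singleton (w : List α) (a : α) :
    listShape (w ++ [a]) =
      .node () (listShape (w.filter (· ≤ a))) (listShape (w.filter (a < ·))) := by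
  simp only [listShape, List.foldr_append, List.foldr_cons, List.foldr_nil, bstInsert,
    foldr_bstInsert_node, BinaryTree.map]

theorem numNodes_map_bstInsert (a : α) (T : BinaryTree α) :
    ((bstInsert a T).map fun _ => ()).numNodes = (T.map fun _ => ()).numNodes + 1 := by
  induction T with
  | nil => rfl
  | node b l r ihl ihr =>
    rw [bstInsert]
    split_ifs <;> simp only [BinaryTree.map, BinaryTree.numNodes, ihl, ihr] <;> omega

theorem numNodes_listShape (w : List α) : (listShape w).numNodes = w.length := by
  induction w with
  | nil => rfl
  | cons a w ih => exact (numNodes_map_bstInsert a _).trans (congrArg (· + 1) ih)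

section Filter

variable {ι : Type*} [LinearOrder ι] {e : ι → α} {w : List α} {x : ι} {j : α}

omit [LinearOrder α] [LinearOrder ι] in
theorem mem_iff_exists_ne (he : Function.Injective e) (hx : e x ∉ w)
    (hmem : ∀ j, j ∈ w ++ [e x] ↔ ∃ y, e y = j) : j ∈ w ↔ ∃ y ≠ x, e y = j := by
  constructor
  · intro hj
    obtain ⟨y, rfl⟩ := (hmem j).1 (List.mem_append_left _ hj)
    exact ⟨y, fun h => hx (h ▸ hj), rfl⟩
  · rintro ⟨y, hy, rfl⟩
    refine (List.mem_append.1 ((hmem _).2 ⟨y, rfl⟩)).resolve_right fun h => hy (he ?_)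
    exact List.mem_singleton.1 h

theorem mem_filter_le_iff (he : StrictMono e) (hmem : ∀ j, j ∈ w ↔ ∃ y ≠ x, e y = j) :
    j ∈ w.filter (· ≤ e x) ↔ ∃ y < x, e y = j := by
  simp only [List.mem_filter, hmem, decide_eq_true_eq]
  constructor
  · rintro ⟨⟨y, hy, rfl⟩, hle⟩
    exact ⟨y, lt_of_le_of_ne (he.le_iff_le.1 hle) hy, rfl⟩
  · rintro ⟨y, hy, rfl⟩
    exact ⟨⟨y, hy.ne, rfl⟩, (he hy).le⟩

theorem mem_filter_lt_iff (he : StrictMono e) (hmem : ∀ j, j ∈ w ↔ ∃ y ≠ x, e y = j) :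
    j ∈ w.filter (e x < ·) ↔ ∃ y > x, e y = j := by
  simp only [List.mem_filter, hmem, decide_eq_true_eq]
  constructor
  · rintro ⟨⟨y, -, rfl⟩, hlt⟩
    exact ⟨y, he.lt_iff_lt.1 hlt, rfl⟩
  · rintro ⟨y, hy, rfl⟩
    exact ⟨⟨y, hy.ne', rfl⟩, he hy⟩

end Filter

theorem listShape_append_singleton_eq_node_iff {u : Unit} {l r : BinaryTree Unit}
    {e : Fin (BinaryTree.node u l r).numNodes → α} (he : StrictMono e) {w : List α}
    (hw : w.Nodup) {x} (hmem : ∀ j, j ∈ w ↔ ∃ y ≠ x, e y = j) :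
    listShape (w ++ [e x]) = .node u l r ↔ x = infixRoot ∧
      listShape (w.filter (· ≤ e x)) = l ∧ listShape (w.filter (e x < ·)) = r := by
  rw [listShape_append_singleton, BinaryTree.node.injEq, and_iff_right rfl, iff_and_self]
  rintro ⟨hl, -⟩
  have hcard : (w.filter (· ≤ e x)).toFinset = (Iio x).map ⟨e, he.injective⟩ := by
    ext j
    rw [List.mem_toFinset, mem_filter_le_iff he hmem, mem_map]
    simp only [mem_Iio, Function.Embedding.coeFn_mk]
  refine Fin.ext (Eq.trans ?_ (congrArg BinaryTree.numNodes hl))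
  rw [numNodes_listShape, ← List.toFinset_card_of_nodup (hw.filter _), hcard, card_map,
    Fin.card_Iio]

theorem listShape_eq_iff {k : α → κ} {T : BinaryTree Unit} {e : Fin T.numNodes → α}
    (he : StrictMono e) {w : List α} (hw : w.Pairwise (k · < k ·))
    (hmem : ∀ j, j ∈ w ↔ ∃ y, e y = j) :
    listShape w = T ↔ HeapOrdered T (k ∘ e) := by
  induction T generalizing w with
  | nil =>
    obtain rfl : w = [] := List.eq_nil_iff_forall_not_mem.2 fun j hj =>
      ((hmem j).1 hj).elim fun y _ => y.elim0
    exact iff_of_true rfl trivial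
  | node u l r ihl ihr =>
    obtain rfl | ⟨w, a, rfl⟩ := List.eq_nil_or_concat' w
    · exact absurd ((hmem _).2 ⟨infixRoot, rfl⟩) List.not_mem_nil
    obtain ⟨x, rfl⟩ := (hmem a).1 (by simp)
    rw [List.pairwise_append] at hw
    obtain ⟨hw, -, hlt⟩ := hw
    replace hlt : ∀ j ∈ w, k j < k (e x) := fun j hj => hlt j hj _ (List.mem_singleton_self _)
    replace hmem : ∀ j, j ∈ w ↔ ∃ y ≠ x, e y = j := fun j =>
      mem_iff_exists_ne he.injective (fun hx => lt_irrefl _ (hlt _ hx)) hmem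
    have hlt' : ∀ y ≠ x, k (e y) < k (e x) := fun y hy => hlt _ ((hmem _).2 ⟨y, hy, rfl⟩)
    rw [listShape_append_singleton_eq_node_iff he (hw.imp fun h => ne_of_apply_ne k h.ne) hmem]
    suffices h : x = infixRoot → (listShape (w.filter (· ≤ e x)) = l ∧
        listShape (w.filter (e x < ·)) = r ↔ HeapOrdered _ (k ∘ e)) by
      refine ⟨fun h' => (h h'.1).1 h'.2, fun h' => ?_⟩
      have hx : x = infixRoot := by_contra fun hx => (hlt' _ (Ne.symm hx)).not_ge (h'.le_root x)
      exact ⟨hx, (h hx).2 h'⟩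
    rintro rfl
    rw [ihl (he.comp strictMono_infixLeft) (hw.filter _) fun j =>
        (mem_filter_le_iff he hmem).trans exists_lt_infixRoot_and,
      ihr (he.comp strictMono_infixRight) (hw.filter _) fun j =>
        (mem_filter_lt_iff he hmem).trans exists_gt_infixRoot_and]
    exact ⟨fun h => ⟨fun i => hlt' _ (infixLeft_lt_infixRoot i).ne,
      fun i => hlt' _ (infixRoot_lt_infixRight i).ne', h⟩, fun h => h.2.2⟩

theorem bstShape_sort_eq_iff {T : BinaryTree Unit} {k : Fin T.numNodes → κ}
    (hk : Function.Injective k) : bstShape (Tuple.sort k) = T ↔ HeapOrdered T k := by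
  refine listShape_eq_iff (w := List.ofFn (Tuple.sort k)) strictMono_id ?_ fun j => ?_
  · rw [List.pairwise_ofFn]
    exact fun i j hij => (sort_eq_iff_of_injective hk).1 rfl hij
  · simpa [List.mem_ofFn] using (Tuple.sort k).surjective j

end ListShape

/-! ### The major index and the shape of the binary search tree -/

theorem qPoch_mul_inv_cancel (K : Type*) [Field K] (n : ℕ) : qPoch K n * (qPoch K n)⁻¹ = 1 :=
  PowerSeries.mul_inv_cancel _ <| by simp [qPoch, map_prod]

theorem hasSum_C_sort_sortKey {K : Type*} [Field K] [UniformSpace K] [DiscreteUniformity K]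
    {n : ℕ} {ω : Fin n → ℤ} (hω : Function.Injective ω) (c : Equiv.Perm (Fin n) → K) :
    HasSum (fun f : Fin n → ℕ => C (c (Tuple.sort (sortKey f ω))) * X ^ ∑ i, f i)
      (∑ σ, C (c σ) * (X ^ maj (ω ∘ σ) * (qPoch K n)⁻¹)) := by
  have h (σ : Equiv.Perm (Fin n)) :=
    (hasSum_subtype_iff_indicator (f := fun f : Fin n → ℕ => (X : K⟦X⟧) ^ ∑ i, f i)
      (s := {f | Tuple.sort (sortKey f ω) = σ})).1 (hasSum_sort_sortKey_eq hω σ)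
  refine (congrArg (HasSum · _) (funext fun f => ?_)).mp
    (hasSum_sum fun σ _ => (h σ).mul_left (C (c σ)))
  simp only [Set.indicator_apply, Set.mem_ofPred_eq, mul_ite, mul_zero, sum_ite_eq, mem_univ,
    if_true]

theorem sum_X_pow_maj_bstShape_eq (K : Type*) [Field K] (T : BinaryTree Unit)
    {ω : Fin T.numNodes → ℤ} (hω : Function.Injective ω) :
    ∑ σ : Equiv.Perm (Fin T.numNodes) with bstShape σ = T, (X : K⟦X⟧) ^ maj (ω ∘ σ) =
      qPoch K T.numNodes * (X ^ treeMaj T ω * hookSeries K T) := by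
  let : UniformSpace K := ⊥
  have : DiscreteUniformity K := ⟨rfl⟩
  have h1 := hasSum_C_sort_sortKey (K := K) hω fun σ => if bstShape σ = T then 1 else 0
  have h2 := (hasSum_subtype_iff_indicator (f := fun f : Fin T.numNodes → ℕ => X ^ ∑ i, f i)
    (s := {f | HeapOrdered T (sortKey f ω)})).1 (hasSum_heapFilling (K := K) T ω)
  have h := h2.unique <| (congrArg (HasSum · _) (funext fun f => ?_)).mp h1
  · rw [h, sum_filter, mul_sum]
    refine sum_congr rfl fun σ _ => ?_
    split_ifs
    · rw [map_one, one_mul, mul_left_comm, qPoch_mul_inv_cancel, mul_one]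
    · rw [map_zero, zero_mul, mul_zero]
  · by_cases hf : HeapOrdered T (sortKey f ω)
    · rw [if_pos ((bstShape_sort_eq_iff (sortKey_injective hω)).2 hf), map_one, one_mul,
        Set.indicator_of_mem (show f ∈ {f | HeapOrdered T (sortKey f ω)} from hf)]
    · rw [if_neg (mt (bstShape_sort_eq_iff (sortKey_injective hω)).1 hf), map_zero, zero_mul,
        Set.indicator_of_notMem (show f ∉ {f | HeapOrdered T (sortKey f ω)} from hf)]

/-! ### Summation over the signs -/

section Nodes

/-- The data of the nodes listed by `nodesAux`, as a function of their number in infix order. -/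
def nodeAt : ℕ → Bool → (T : BinaryTree Unit) → Fin T.numNodes → NodeData
  | _, _, .nil => Fin.elim0
  | o, b, .node _ l r =>
    infixElim (nodeAt o false l) ⟨l.numNodes + r.numNodes + 1, l.numNodes, b, o + l.numNodes + 1⟩
      (nodeAt (o + l.numNodes + 1) true r)

theorem prod_map_nodesAux {M : Type*} [CommMonoid M] (h : NodeData → M) (o : ℕ) (b : Bool)
    (T : BinaryTree Unit) : ((nodesAux o b T).map h).prod = ∏ x, h (nodeAt o b T x) := by
  induction T generalizing o b with
  | nil => rfl
  | node u l r ihl ihr =>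
    simp only [nodesAux, nodeAt, List.map_append, List.map_cons, List.prod_append, List.prod_cons,
      ihl, ihr, prod_infix, infixElim_left, infixElim_root, infixElim_right, mul_assoc]

theorem label_nodeAt (o : ℕ) (b : Bool) (T : BinaryTree Unit) (x : Fin T.numNodes) :
    (nodeAt o b T x).label = o + x + 1 := by
  induction T generalizing o b with
  | nil => exact x.elim0
  | node u l r ihl ihr =>
    induction x using infix_cases with
    | left i => rw [nodeAt, infixElim_left, ihl]; rfl
    | root => rw [nodeAt, infixElim_root]; rfl
    | right i => rw [nodeAt, infixElim_right, ihr, infixRight]; ring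

/-- The contribution of a node whose label has a given sign. -/
def signedHook (K : Type*) [Field K] (e : ℤˣ) (s : NodeData) : K⟦X⟧ :=
  (if e = -1 then X ^ s.leftSize else if s.isRightSon then X ^ s.size else 1) *
    (1 - X ^ s.size)⁻¹

theorem hookContent_eq_sum_signedHook {K : Type*} [Field K] (u : K) (s : NodeData) :
    hookContent u s = ∑ e : ℤˣ, (if e = -1 then C (-u) else 1) * signedHook K e s := by
  rw [UnitsInt.univ, sum_pair (by decide)]
  simp only [show (1 : ℤˣ) ≠ -1 by decide, if_false, if_true, map_neg, hookContent, signedHook]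
  ring

variable {K : Type*} [Field K] {T : BinaryTree Unit} {ω : Fin T.numNodes → ℤ}
  {δ : Fin T.numNodes → ℤˣ}

theorem prod_signedHook_nodeAt_true {v : ℤ} (h : ∀ x, ω x < v ↔ δ x = -1) (o : ℕ) :
    ∏ x, signedHook K (δ x) (nodeAt o true T x) =
      X ^ (T.numNodes * gap T ω v) * ∏ x, signedHook K (δ x) (nodeAt o false T x) := by
  cases T with
  | nil => rw [gap, mul_zero, pow_zero, one_mul]; rfl
  | node u l r =>
    rw [prod_infix, prod_infix]
    simp only [nodeAt, infixElim_left, infixElim_root, infixElim_right, gap, h]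
    by_cases hroot : δ infixRoot = -1
    · simp only [signedHook, hroot, if_true, mul_zero, pow_zero, one_mul]
    · simp only [signedHook, hroot, if_true, if_false, Bool.false_eq_true, mul_one, one_mul]
      rw [BinaryTree.numNodes]
      ring

theorem numNodes_mul_gap {v : ℤ} {c : Prop} [Decidable c] (h : ∀ x, ω x < v ↔ c) :
    T.numNodes * gap T ω v = if c then 0 else T.numNodes := by
  cases T with
  | nil => simp [BinaryTree.numNodes]
  | node u l r => simp only [gap, h, mul_ite, mul_zero, mul_one]

theorem prod_signedHook_nodeAt_false (hω : Function.Injective ω)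
    (hδ : ∀ x y, x < y → (ω x < ω y ↔ δ y = 1)) (o : ℕ) :
    ∏ x, signedHook K (δ x) (nodeAt o false T x) = X ^ treeMaj T ω * hookSeries K T := by
  induction T generalizing o with
  | nil => rw [treeMaj, hookSeries, pow_zero, one_mul]; rfl
  | node u l r ihl ihr =>
    have hl : ∀ x, ω (infixLeft x) < ω infixRoot ↔ δ infixRoot = 1 := fun x =>
      hδ _ _ (infixLeft_lt_infixRoot x)
    have hr : ∀ x, ω (infixRight x) < ω infixRoot ↔ δ (infixRight x) = -1 := by
      intro x
      rw [← Int.units_ne_iff_eq_neg, Ne, ← hδ _ _ (infixRoot_lt_infixRight x), not_lt,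
        (hω.ne (infixRoot_lt_infixRight x).ne').le_iff_lt]
    have hroot (m : ℕ) : signedHook K (δ infixRoot)
        ⟨l.numNodes + r.numNodes + 1, l.numNodes, false, m⟩ =
        X ^ (l.numNodes * gap l (ω ∘ infixLeft) (ω infixRoot)) *
          (1 - X ^ (l.numNodes + r.numNodes + 1))⁻¹ := by
      rw [numNodes_mul_gap (ω := ω ∘ infixLeft) hl]
      rcases Int.units_eq_one_or (δ infixRoot) with h | h <;> simp [signedHook, h]
    rw [prod_infix]
    simp only [nodeAt, infixElim_left, infixElim_root, infixElim_right, hroot,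
      prod_signedHook_nodeAt_true hr, treeMaj, hookSeries]
    rw [ihl (hω.comp strictMono_infixLeft.injective) fun x y h => hδ _ _ (strictMono_infixLeft h),
      ihr (hω.comp strictMono_infixRight.injective) fun x y h => hδ _ _ (strictMono_infixRight h)]
    simp only [pow_add, Function.comp_def]
    ring

end Nodes

section SignedWord

variable {n : ℕ}

theorem signedWord_one_comp (σ : Equiv.Perm (Fin n)) (δ : Fin n → ℤˣ) :
    signedWord 1 δ ∘ σ = signedWord σ (δ ∘ σ) := rfl

theorem natAbs_signedWord (σ : Equiv.Perm (Fin n)) (ε : Fin n → ℤˣ) (i : Fin n) :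
    (signedWord σ ε i).natAbs = σ i + 1 := by
  rw [signedWord, Int.natAbs_mul, Int.units_natAbs, one_mul]
  rfl

theorem signedWord_injective (σ : Equiv.Perm (Fin n)) (ε : Fin n → ℤˣ) :
    Function.Injective (signedWord σ ε) := fun i j h => by
  have h := congrArg Int.natAbs h
  rw [natAbs_signedWord, natAbs_signedWord] at h
  exact σ.injective (Fin.ext (Nat.succ_injective h))

theorem signedWord_one_lt_iff {δ : Fin n → ℤˣ} {x y : Fin n} (h : x < y) :
    signedWord 1 δ x < signedWord 1 δ y ↔ δ y = 1 := by
  have hxy : (x : ℕ) < y := h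
  rcases Int.units_eq_one_or (δ x) with hx | hx <;>
    rcases Int.units_eq_one_or (δ y) with hy | hy <;>
    simp [signedWord, hx, hy] <;> omega

theorem sum_signs_eq_sum_signs_comp {M : Type*} [AddCommMonoid M] (σ : Equiv.Perm (Fin n))
    (g : (Fin n → ℤˣ) → M) : ∑ ε, g ε = ∑ δ : Fin n → ℤˣ, g (δ ∘ σ) :=
  (Equiv.sum_comp (σ.symm.arrowCongr (Equiv.refl ℤˣ)) g).symm

theorem prod_filter_comp_eq_neg_one {M : Type*} [CommMonoid M] (σ : Equiv.Perm (Fin n))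
    (δ : Fin n → ℤˣ) (c : Fin n → M) :
    ∏ i with (δ ∘ σ) i = -1, c (σ i) = ∏ x with δ x = -1, c x := by
  rw [prod_filter, prod_filter]
  exact Equiv.prod_comp σ fun x => if δ x = -1 then c x else 1

theorem numNeg_comp (σ : Equiv.Perm (Fin n)) (δ : Fin n → ℤˣ) : numNeg (δ ∘ σ) = numNeg δ := by
  rw [numNeg, numNeg]
  exact card_equiv σ fun i => by simp

end SignedWord

theorem sum_X_pow_maj_signedWord_one {K : Type*} [Field K] {T : BinaryTree Unit}
    (δ : Fin T.numNodes → ℤˣ) :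
    ∑ σ : Equiv.Perm (Fin T.numNodes) with bstShape σ = T,
        (X : K⟦X⟧) ^ maj (signedWord 1 δ ∘ σ) =
      qPoch K T.numNodes * ∏ x, signedHook K (δ x) (nodeAt 0 false T x) := by
  rw [sum_X_pow_maj_bstShape_eq K T (signedWord_injective 1 δ),
    prod_signedHook_nodeAt_false (signedWord_injective 1 δ) fun _ _ => signedWord_one_lt_iff]

theorem signedGFLabels_eq {K : Type*} [Field K] (u : ℕ → K) (T : BinaryTree Unit) :
    signedGFLabels (fun j => -u j) T =
      qPoch K T.numNodes * ((nodes T).map fun s => hookContent (u s.label) s).prod := by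
  calc signedGFLabels (fun j => -u j) T
    _ = ∑ σ : Equiv.Perm (Fin T.numNodes) with bstShape σ = T, ∑ δ : Fin T.numNodes → ℤˣ,
          (∏ x with δ x = -1, C (-u (x + 1))) * X ^ maj (signedWord 1 δ ∘ σ) := by
        refine sum_congr rfl fun σ _ => ?_
        rw [sum_signs_eq_sum_signs_comp σ]
        simp only [prod_filter_comp_eq_neg_one σ _ fun x => C (-u (x + 1)), signedWord_one_comp]
    _ = qPoch K T.numNodes * ∑ δ : Fin T.numNodes → ℤˣ,
          (∏ x with δ x = -1, C (-u (x + 1))) *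
            ∏ x, signedHook K (δ x) (nodeAt 0 false T x) := by
        rw [sum_comm, mul_sum]
        refine sum_congr rfl fun δ _ => ?_
        rw [← mul_sum, sum_X_pow_maj_signedWord_one, mul_left_comm]
    _ = qPoch K T.numNodes * ∏ x : Fin T.numNodes, ∑ e : ℤˣ,
          (if e = -1 then C (-u (x + 1)) else 1) * signedHook K e (nodeAt 0 false T x) := by
        simp only [prod_univ_sum, Fintype.piFinset_univ, prod_mul_distrib, prod_filter]
    _ = qPoch K T.numNodes * ((nodes T).map fun s => hookContent (u s.label) s).prod := by
        simp only [nodes, prod_map_nodesAux, hookContent_eq_sum_signedHook, label_nodeAt, zero_add]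

theorem signedGF_eq_signedGFLabels {K : Type*} [Field K] (t : K) (T : BinaryTree Unit) :
    signedGF t T = signedGFLabels (fun _ => t) T := by
  simp only [signedGF, signedGFLabels, numNeg, prod_const]

/-! ### The specialization at `1 / (1 - q)` -/

theorem sort_sortKey_of_strictMono {ι : Type*} [LinearOrder ι] {n : ℕ} {ω : Fin n → ι}
    (hω : StrictMono ω) (w : Fin n → ℕ) :
    Tuple.sort (sortKey w ω) = Tuple.sort fun i => OrderDual.toDual (w i) := by
  obtain ⟨hmono, hties⟩ := Tuple.eq_sort_iff.1
    (rfl : Tuple.sort (fun i => OrderDual.toDual (w i)) = _)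
  rw [sort_eq_iff_of_injective (sortKey_injective hω.injective)]
  refine fun i j hij => sortKey_lt_iff.2 ?_
  rcases (OrderDual.toDual_le_toDual.1 (hmono hij.le)).lt_or_eq with h | h
  · exact Or.inl h
  · exact Or.inr ⟨h.symm, hω (hties i j hij h.symm)⟩

theorem hasSum_specGeom {K : Type*} [Field K] [UniformSpace K] [DiscreteUniformity K] {n : ℕ}
    (x : FQSym K n) :
    HasSum (fun w : Fin n → ℕ =>
      C (gCoeff x (std fun i => OrderDual.toDual (w i))) * X ^ ∑ i, w i) (specGeom x) := by
  rw [WithPiTopology.hasSum_iff_hasSum_coeff]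
  intro d
  have h (w : Fin n → ℕ) : coeff d (C (gCoeff x (std fun i => OrderDual.toDual (w i))) *
      X ^ ∑ i, w i) = if w ∈ Finset.Nat.antidiagonalTuple n d then
        gCoeff x (std fun i => OrderDual.toDual (w i)) else 0 := by
    simp only [coeff_C_mul, coeff_X_pow, mul_ite, mul_one, mul_zero,
      Finset.Nat.mem_antidiagonalTuple, eq_comm]
  simp only [h, specGeom, coeff_mk]
  rw [← sum_congr rfl fun w hw => if_pos hw]
  exact hasSum_sum_of_ne_finset_zero fun w hw => if_neg hw

theorem qPoch_mul_specGeom {K : Type*} [Field K] {n : ℕ} (x : FQSym K n) :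
    qPoch K n * specGeom x = ∑ τ, C (x.coeff τ) * X ^ maj (fun i => (τ i : ℤ)) := by
  let : UniformSpace K := ⊥
  have : DiscreteUniformity K := ⟨rfl⟩
  have hω : StrictMono fun i : Fin n => ((i : ℕ) : ℤ) := fun i j h => Nat.cast_lt.2 h
  have h := hasSum_C_sort_sortKey (K := K) hω.injective x.coeff
  simp only [sort_sortKey_of_strictMono hω] at h
  have h' := hasSum_specGeom x
  simp only [gCoeff, std, inv_inv] at h'
  rw [h'.unique h, mul_sum]
  refine sum_congr rfl fun τ _ => ?_
  rw [mul_left_comm, mul_left_comm (qPoch K n), qPoch_mul_inv_cancel, mul_one]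
  rfl

/-! ### The transformation `A ↦ A·(1-t)` -/

theorem coeff_F_mul {K : Type*} [Field K] {n : ℕ} (σ τ : Equiv.Perm (Fin n)) (x : FQSym K n) :
    (F K σ * x).coeff τ = x.coeff (σ⁻¹ * τ) := by
  simp [F]

theorem sum_coeff_smul_F {K : Type*} [Field K] {n : ℕ} (x : FQSym K n) :
    ∑ σ, x.coeff σ • F K σ = x := by
  ext σ
  simp [F]

theorem mulOneSub_eq_mul {K : Type*} [Field K] (t : K) {n : ℕ} (x : FQSym K n) :
    mulOneSub t x = completeOneSub t n * x := by
  nth_rw 2 [← sum_coeff_smul_F x]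
  ext τ
  simp [mulOneSub, pairing, oneSubMul, G, F, mul_sum, Finsupp.single_apply, mul_comm]

section Valley

variable {n : ℕ}

/-- The permutation `γ` is decreasing on its first `k` letters and increasing on the other ones;
these are the permutations whose `G_γ` occur in `Λ_k S_{n-k}`. -/
def IsValley (k : ℕ) (γ : Equiv.Perm (Fin n)) : Prop :=
  StrictAntiOn γ {i | (i : ℕ) < k} ∧ StrictMonoOn γ {i | k ≤ (i : ℕ)}

theorem std_eq_one_iff {α : Type*} [LinearOrder α] {w : Fin n → α} (hw : Function.Injective w) :
    std w = 1 ↔ StrictMono w := by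
  rw [std, inv_eq_one, sort_eq_iff_of_injective hw]
  rfl

theorem std_eq_revPerm_iff {α : Type*} [LinearOrder α] {w : Fin n → α}
    (hw : Function.Injective w) : std w = Fin.revPerm ↔ StrictAnti w := by
  rw [std, inv_eq_iff_eq_inv, sort_eq_iff_of_injective hw]
  refine ⟨fun h i j hij => ?_, fun h => h.comp fun i j => Fin.rev_lt_rev.2⟩
  simpa using h (Fin.rev_lt_rev.2 hij)

theorem isValley_iff {k l : ℕ} {γ : Equiv.Perm (Fin (k + l))} :
    IsValley k γ ↔
      StrictAnti (γ ∘ Fin.castAdd l) ∧ StrictMono (γ ∘ Fin.natAdd k) := by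
  refine and_congr ⟨fun h i j hij => h i.2 j.2 hij, fun h i hi j hj hij => ?_⟩
    ⟨fun h i j hij => h (by simp) (by simp) (by simpa using hij), fun h i hi j hj hij => ?_⟩
  · exact h (a := ⟨i, hi⟩) (b := ⟨j, hj⟩) hij
  · induction i using Fin.addCases with
    | left i => exact absurd hi (by simp)
    | right i =>
      induction j using Fin.addCases with
      | left j => exact absurd hj (by simp)
      | right j => exact h (by simpa using hij)

open Classical in
theorem outer_elemLambda_completeS (K : Type*) [Field K] {k l : ℕ} (h : k + l = n) :
    outer h (elemLambda K k) (completeS K l) = ∑ γ with IsValley k γ, G K γ := by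
  subst h
  have hcoeff {m : ℕ} (σ τ : Equiv.Perm (Fin m)) : gCoeff (G K σ) τ = if τ = σ then 1 else 0 := by
    simp [gCoeff, G, F, Finsupp.single_apply, eq_comm]
  rw [outer, sum_filter]
  refine sum_congr rfl fun γ _ => ?_
  have hΛ : std (fun i => γ (Fin.castAdd l i)) = Fin.revPerm ↔ StrictAnti (γ ∘ Fin.castAdd l) :=
    std_eq_revPerm_iff (γ.injective.comp (Fin.castAdd_injective k l))
  have hS : std (fun j => γ (Fin.natAdd k j)) = 1 ↔ StrictMono (γ ∘ Fin.natAdd k) :=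
    std_eq_one_iff (γ.injective.comp (Fin.natAdd_injective l k))
  simp only [elemLambda, completeS, hcoeff, isValley_iff, ← hΛ, ← hS, Fin.cast_eq_self,
    ite_and, ite_mul, one_mul, zero_mul, ite_smul, one_smul, zero_smul]

theorem signedWord_neg_iff {σ : Equiv.Perm (Fin n)} {ε : Fin n → ℤˣ} {i : Fin n} :
    signedWord σ ε i < 0 ↔ ε i = -1 := by
  rcases Int.units_eq_one_or (ε i) with h | h <;> simp [signedWord, h] <;> omega

theorem signedWord_lt_signedWord_iff {σ : Equiv.Perm (Fin n)} {ε : Fin n → ℤˣ} {i j : Fin n} :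
    signedWord σ ε i < signedWord σ ε j ↔
      ε i = -1 ∧ ε j = 1 ∨ ε i = -1 ∧ ε j = -1 ∧ σ j < σ i ∨ ε i = 1 ∧ ε j = 1 ∧ σ i < σ j := by
  rcases Int.units_eq_one_or (ε i) with hi | hi <;>
    rcases Int.units_eq_one_or (ε j) with hj | hj <;>
    simp [signedWord, hi, hj] <;> omega

/-- The signs of the labels that make the first `k` letters of `γ` negative. -/
def valleySigns (k : ℕ) (γ : Equiv.Perm (Fin n)) (x : Fin n) : ℤˣ :=
  if (γ.symm x : ℕ) < k then -1 else 1

theorem valleySigns_apply_eq_neg_one_iff {k : ℕ} {γ : Equiv.Perm (Fin n)} {i : Fin n} :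
    valleySigns k γ (γ i) = -1 ↔ (i : ℕ) < k := by
  rw [valleySigns, Equiv.symm_apply_apply]
  split_ifs with h <;> simp [h]

theorem numNeg_valleySigns {k : ℕ} (hk : k ≤ n) (γ : Equiv.Perm (Fin n)) :
    numNeg (valleySigns k γ) = k := by
  rw [← numNeg_comp γ, numNeg]
  simp only [Function.comp_apply, valleySigns_apply_eq_neg_one_iff]
  rw [Fin.card_filter_val_lt, min_eq_right hk]

theorem strictMono_signedWord_valleySigns {k : ℕ} {γ : Equiv.Perm (Fin n)} (h : IsValley k γ) :
    StrictMono (signedWord γ (valleySigns k γ ∘ γ)) := by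
  intro i j hij
  have hsign {i : Fin n} : valleySigns k γ (γ i) = 1 ↔ k ≤ (i : ℕ) := by
    rw [← not_lt, ← valleySigns_apply_eq_neg_one_iff (γ := γ), ← Ne, Int.units_ne_iff_eq_neg,
      neg_neg]
  simp only [signedWord_lt_signedWord_iff, Function.comp_apply, hsign,
    valleySigns_apply_eq_neg_one_iff]
  rcases lt_or_ge (i : ℕ) k with hi | hi <;> rcases lt_or_ge (j : ℕ) k with hj | hj
  · exact Or.inr (Or.inl ⟨hi, hj, h.1 hi hj hij⟩)
  · exact Or.inl ⟨hi, hj⟩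
  · exact absurd (hj.trans_le hi) hij.not_gt
  · exact Or.inr (Or.inr ⟨hi, hj, h.2 hi hj hij⟩)

theorem eq_neg_one_iff_of_strictMono_signedWord {γ : Equiv.Perm (Fin n)} {ε : Fin n → ℤˣ}
    (h : StrictMono (signedWord γ ε)) {i : Fin n} : ε i = -1 ↔ (i : ℕ) < numNeg ε := by
  simp only [numNeg, ← signedWord_neg_iff (σ := γ) (ε := ε)]
  exact (Tuple.lt_card_lt_iff_apply_lt_of_monotone h.monotone).symm

theorem isValley_of_strictMono_signedWord {γ : Equiv.Perm (Fin n)} {ε : Fin n → ℤˣ}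
    (h : StrictMono (signedWord γ ε)) : IsValley (numNeg ε) γ := by
  have hneg {i : Fin n} := eq_neg_one_iff_of_strictMono_signedWord h (i := i)
  have hpos {i : Fin n} (hi : numNeg ε ≤ (i : ℕ)) : ε i = 1 :=
    (Int.units_eq_one_or _).resolve_right (mt hneg.1 hi.not_gt)
  constructor
  · intro i hi j hj hij
    simpa [signedWord_lt_signedWord_iff, hneg.2 hi, hneg.2 hj] using h hij
  · intro i hi j hj hij
    simpa [signedWord_lt_signedWord_iff, hpos hi, hpos hj] using h hij

theorem valleySigns_numNeg {γ : Equiv.Perm (Fin n)} {δ : Fin n → ℤˣ}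
    (h : StrictMono (signedWord γ (δ ∘ γ))) : valleySigns (numNeg δ) γ = δ := by
  funext x
  have hx := eq_neg_one_iff_of_strictMono_signedWord h (i := γ.symm x)
  rw [Function.comp_apply, Equiv.apply_symm_apply, numNeg_comp] at hx
  rw [valleySigns]
  split_ifs with hlt
  · exact (hx.2 hlt).symm
  · exact ((Int.units_eq_one_or _).resolve_right (mt hx.1 hlt)).symm

open Classical in
theorem sum_G_isValley (K : Type*) [Field K] {k : ℕ} (hk : k ≤ n) :
    ∑ γ : Equiv.Perm (Fin n) with IsValley k γ, G K γ =
      ∑ δ : Fin n → ℤˣ with numNeg δ = k, F K (std (signedWord 1 δ)) := by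
  have hsort {δ : Fin n → ℤˣ} {γ : Equiv.Perm (Fin n)} :
      Tuple.sort (signedWord 1 δ) = γ ↔ StrictMono (signedWord γ (δ ∘ γ)) :=
    sort_eq_iff_of_injective (signedWord_injective 1 δ)
  have hleft {γ : Equiv.Perm (Fin n)} (h : IsValley k γ) :
      Tuple.sort (signedWord 1 (valleySigns k γ)) = γ :=
    hsort.2 (strictMono_signedWord_valleySigns h)
  refine sum_nbij' (valleySigns k) (fun δ => Tuple.sort (signedWord 1 δ)) (fun γ _ => ?_)
    (fun δ hδ => ?_) (fun γ hγ => hleft (mem_filter.1 hγ).2) (fun δ hδ => ?_) fun γ hγ => ?_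
  · exact mem_filter.2 ⟨mem_univ _, numNeg_valleySigns hk γ⟩
  · have := isValley_of_strictMono_signedWord (hsort.1 (Eq.refl (Tuple.sort (signedWord 1 δ))))
    rw [numNeg_comp, (mem_filter.1 hδ).2] at this
    exact mem_filter.2 ⟨mem_univ _, this⟩
  · rw [← (mem_filter.1 hδ).2]
    exact valleySigns_numNeg (hsort.1 rfl)
  · rw [std, hleft (mem_filter.1 hγ).2, G]

theorem completeOneSub_eq_sum_signs {K : Type*} [Field K] (t : K) (n : ℕ) :
    completeOneSub t n = ∑ δ : Fin n → ℤˣ, (-t) ^ numNeg δ • F K (std (signedWord 1 δ)) := by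
  classical
  have hle (δ : Fin n → ℤˣ) : numNeg δ ∈ range (n + 1) :=
    mem_range_succ_iff.2 ((card_le_univ _).trans_eq (Fintype.card_fin n))
  calc completeOneSub t n
    _ = ∑ p ∈ antidiagonal n, (-t) ^ p.1 • ∑ γ : Equiv.Perm (Fin n) with IsValley p.1 γ, G K γ := by
        simp only [completeOneSub, outer_elemLambda_completeS]
        exact sum_attach (antidiagonal n)
          fun p => (-t) ^ p.1 • ∑ γ : Equiv.Perm (Fin n) with IsValley p.1 γ, G K γ
    _ = ∑ k ∈ range (n + 1), (-t) ^ k • ∑ γ : Equiv.Perm (Fin n) with IsValley k γ, G K γ :=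
        Finset.Nat.sum_antidiagonal_eq_sum_range_succ_mk _ n
    _ = ∑ k ∈ range (n + 1), ∑ δ : Fin n → ℤˣ with numNeg δ = k,
          (-t) ^ numNeg δ • F K (std (signedWord 1 δ)) := by
        refine sum_congr rfl fun k hk => ?_
        rw [sum_G_isValley K (mem_range_succ_iff.1 hk), smul_sum]
        exact sum_congr rfl fun δ hδ => by rw [(mem_filter.1 hδ).2]
    _ = ∑ δ : Fin n → ℤˣ, (-t) ^ numNeg δ • F K (std (signedWord 1 δ)) :=
        sum_fiberwise_of_maps_to (fun δ _ => hle δ) _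

end Valley

theorem maj_std_mul {n : ℕ} {ω : Fin n → ℤ} (hω : Function.Injective ω)
    (σ : Equiv.Perm (Fin n)) : maj (fun i => ((std ω * σ) i : ℤ)) = maj (ω ∘ σ) := by
  have hmono : StrictMono (ω ∘ Tuple.sort ω) := (sort_eq_iff_of_injective hω).1 rfl
  have h (i j : Fin n) : (((std ω * σ) i : Fin n) : ℤ) < ((std ω * σ) j : Fin n) ↔
      (ω ∘ σ) i < (ω ∘ σ) j := by
    have := hmono.lt_iff_lt (a := (std ω * σ) i) (b := (std ω * σ) j)
    simp_all [std]
  simp only [maj, h]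

theorem qPoch_mul_specX {K : Type*} [Field K] (t : K) {n : ℕ} (x : FQSym K n) :
    qPoch K n * specX t x = ∑ σ : Equiv.Perm (Fin n), C (x.coeff σ) *
      ∑ ε : Fin n → ℤˣ, C (-t) ^ numNeg ε * X ^ maj (signedWord σ ε) := by
  calc qPoch K n * specX t x
    _ = ∑ δ : Fin n → ℤˣ, ∑ τ : Equiv.Perm (Fin n), C (-t) ^ numNeg δ *
          (C (x.coeff ((std (signedWord 1 δ))⁻¹ * τ)) * X ^ maj fun i => (τ i : ℤ)) := by
        rw [specX, qPoch_mul_specGeom, mulOneSub_eq_mul, completeOneSub_eq_sum_signs, sum_comm]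
        simp only [sum_mul, smul_mul_assoc, MonoidAlgebra.coeff_sum, MonoidAlgebra.coeff_smul,
          Finsupp.finsetSum_apply, Finsupp.smul_apply, coeff_F_mul, smul_eq_mul, map_sum, map_mul,
          map_pow, mul_assoc]
    _ = ∑ δ : Fin n → ℤˣ, ∑ σ : Equiv.Perm (Fin n), C (-t) ^ numNeg δ *
          (C (x.coeff σ) * X ^ maj (signedWord 1 δ ∘ σ)) := by
        refine sum_congr rfl fun δ _ => ?_
        rw [← Equiv.sum_comp (Equiv.mulLeft (std (signedWord 1 δ)))]
        simp only [Equiv.coe_mulLeft, inv_mul_cancel_left, maj_std_mul (signedWord_injective 1 δ)]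
    _ = _ := by
        rw [sum_comm]
        refine sum_congr rfl fun σ _ => ?_
        rw [mul_sum]
        refine .trans (sum_congr rfl fun δ _ => ?_) (sum_signs_eq_sum_signs_comp σ _).symm
        rw [numNeg_comp, signedWord_one_comp, mul_left_comm]

theorem qPoch_mul_specX_P {K : Type*} [Field K] (t : K) (T : BinaryTree Unit) :
    qPoch K T.numNodes * specX t (P K T) = signedGF (-t) T := by
  have hP (σ) : (P K T).coeff σ = if bstShape σ = T then 1 else 0 := by
    simp [P, F, Finsupp.single_apply]
  simp only [qPoch_mul_specX, hP, signedGF, sum_filter, apply_ite C, map_one, map_zero, ite_mul,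
    one_mul, zero_mul]

theorem qPoch_ne_zero (K : Type*) [Field K] (n : ℕ) : qPoch K n ≠ 0 :=
  left_ne_zero_of_mul_eq_one (qPoch_mul_inv_cancel K n)

end HookTree

end

theorem mainTheorem1 {K : Type*} [Field K] (T : BinaryTree Unit) (t : K) :
    -- `P_T(𝕏)` is the product of the hook-content factors of the nodes of `T`
    HookTree.specX t (HookTree.P K T) =
      ((HookTree.nodes T).map (HookTree.hookContent t)).prod ∧
    -- `(q)_n P_T(𝕏) = ∑ (-t)^{m(ε)} q^{maj(σ,ε)}`
    HookTree.qPoch K T.numNodes * HookTree.specX t (HookTree.P K T) =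
      HookTree.signedGF (-t) T ∧
    -- the generating function of signed permutations of shape `T`
    HookTree.signedGF t T =
      HookTree.qPoch K T.numNodes * HookTree.specX (-t) (HookTree.P K T) ∧
    HookTree.signedGF t T =
      HookTree.qPoch K T.numNodes *
        ((HookTree.nodes T).map (HookTree.hookContent (-t))).prod ∧
    -- the factor of a node is the contribution of its label among the signed permutations
    ∀ u : ℕ → K,
      HookTree.signedGFLabels (fun j => -u j) T =
        HookTree.qPoch K T.numNodes *
          ((HookTree.nodes T).map fun s => HookTree.hookContent (u s.label) s).prod := by
  have hGF (t : K) : HookTree.signedGF (-t) T = HookTree.qPoch K T.numNodes *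
      ((HookTree.nodes T).map (HookTree.hookContent t)).prod := by
    rw [HookTree.signedGF_eq_signedGFLabels]
    exact HookTree.signedGFLabels_eq (fun _ => t) T
  refine ⟨?_, HookTree.qPoch_mul_specX_P t T, ?_, ?_, fun u => HookTree.signedGFLabels_eq u T⟩
  · refine mul_left_cancel₀ (HookTree.qPoch_ne_zero K T.numNodes) ?_
    rw [HookTree.qPoch_mul_specX_P, hGF]
  · rw [HookTree.qPoch_mul_specX_P, neg_neg]
  · rw [← hGF, neg_neg]
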